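/- Let $n\ge 1$ and let $C_n$ be the cycle on the vertex set $\{1,\dots,n\}$ with edges $\{1,2\},\{2,3\},\dots,\{n-1,n\},\{n,1\}$, taken as a simple graph (so $C_1$ is a single vertex and $C_2$ a single edge). Let $m\ge 1$ and let $a_1,\dots,a_m,b_1,\dots,b_{m-1}$ be integers with $$1\le a_1<b_1\le a_2<b_2\le\cdots\le a_{m-1}<b_{m-1}\le a_m\le n.$$ Let $G$ be the noncrossing cycle-chord graph obtained from $C_n$ by adding the edges $\{a_1,b_1\},\dots,\{a_{m-1},b_{m-1}\},\{a_m,1\}$, again as a simple graph (an edge that is already present, or the degenerate $\{1,1\}$ when $a_m=1$, adds nothing). These chords may share endpoints but do not cross. Then $G$ is $e$-positive: its chromatic symmetric function $$X_G(x_1,x_2,\dots)=\sum_{\kappa}x_{\kappa(1)}x_{\kappa(2)}\cdots x_{\kappa(n)},$$ where $\kappa$ runs over all proper colourings $\kappa:\{1,\dots,n\}\to\{1,2,3,\dots\}$ of $G$, is a linear combination with nonnegative integer coefficients of the products $e_\lambda=e_{\lambda_1}\cdots e_{\lambda_\ell}$ with $\lambda=(\lambda_1,\dots,\lambda_\ell)$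 a partition of $n$, where $e_k=\sum_{i_1<\cdots<i_k}x_{i_1}\cdots x_{i_k}$ is the $k$-th elementary symmetric function. -/

import Mathlib

namespace ChromSymm

/-- The chromatic symmetric function `X_G = ∑_κ ∏_v x_{κ(v)}`, the sum being over all proper
colourings `κ : V → {1, 2, 3, …}`, as a formal power series in `x₁, x₂, x₃, …`: the coefficient
of the monomial `x ^ d` is the (finite) number of proper colourings `κ` with
`∏_v x_{κ(v)} = x ^ d`. -/
noncomputable def chromSymm {V : Type*} [Fintype V] (G : SimpleGraph V) : MvPowerSeries ℕ+ ℤ :=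
  fun d => (Nat.card {κ : G.Coloring ℕ+ // ∑ v, Finsupp.single (κ v) 1 = d} : ℤ)

/-- The elementary symmetric function `e_k = ∑_{i₁ < ⋯ < i_k} x_{i₁} ⋯ x_{i_k}` in `x₁, x₂, …`:
the sum of all squarefree monomials of degree `k`. -/
noncomputable def elem (k : ℕ) : MvPowerSeries ℕ+ ℤ :=
  Set.indicator {d : ℕ+ →₀ ℕ | d.degree = k ∧ ∀ i, d i ≤ 1} (fun _ => 1)

/-- `e_μ = e_{μ₁} e_{μ₂} ⋯ e_{μ_ℓ}` for a partition `μ`. -/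
noncomputable def elemPart {n : ℕ} (μ : n.Partition) : MvPowerSeries ℕ+ ℤ :=
  (μ.parts.map elem).prod

/-- `G` is `e`-positive: `X_G`, which is homogeneous of degree `|V|`, is a linear combination of
the `e_μ`, for `μ` a partition of `|V|`, with nonnegative coefficients. -/
def IsEPositive {V : Type*} [Fintype V] (G : SimpleGraph V) : Prop :=
  ∃ c : (Fintype.card V).Partition → ℤ,
    (∀ μ, 0 ≤ c μ) ∧ chromSymm G = ∑ μ, c μ • elemPart μ

/-- The cycle `C_n` with the `m = k + 1` further edges `{a₁, b₁}, …, {a_{m-1}, b_{m-1}}` and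
`{a_m, 1}`. The vertices `1, …, n` are the elements `0, …, n - 1` of `Fin n`, so that the
vertex `1` is `0 : Fin n`; `a₁, …, a_m` is `a 0, …, a k` and `b₁, …, b_{m-1}` is
`b 0, …, b (k - 1)`. As the graph is simple, an added edge that is already present changes
nothing, and neither does a degenerate one `{1, 1}`. -/
def cycleChord (n : ℕ) [NeZero n] {k : ℕ} (a : Fin (k + 1) → Fin n) (b : Fin k → Fin n) :
    SimpleGraph (Fin n) :=
  SimpleGraph.cycleGraph n ⊔
    SimpleGraph.fromEdgeSet
      (Set.range (fun i : Fin k => s(a i.castSucc, b i)) ∪ {s(a (Fin.last k), 0)})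

end ChromSymm

/-!
It suffices to use finitely many colours `1, …, N` with `N = |V|`, because a homogeneous symmetric
function of degree `N` is determined by its restriction to `N` variables. There `X_G` is the trace
of a product of transfer matrices, indexed by the colours of two vertices: a step along the cycle
contributes `S = (J - 1) * diag x`, and an arc of `l` inner vertices under a chord contributes the
Hadamard product of `S ^ (l + 1)` with `J - 1`.

Consider the matrix `P` with entries `P a c = x_c * e_a(x ∖ x_c)`, which is nonsingular because
multiplying it by a Vandermonde-type matrix makes it diagonal. For each of these transfer matrices
`Z` there is a matrix `M` with `e`-positive entries such that `P * Z = M * P`. Hence `X_G` is also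
the trace of the product of the matrices `M`, which is `e`-positive.

The matrices `M` come from the generating function of walks: the matrix of an arc of `l` inner
vertices is `∑_{i + b = l} h_i * K_b`, where `K_b c z = x_z * e_b(x ∖ {x_c, x_z})` for `c ≠ z` and
`∑ h_i t ^ i = 1 / (E(t) - t * E'(t))`. As `E(t) - t * E'(t) = 1 - ∑ (k - 1) * e_k * t ^ k`, the
`h_i` are `e`-positive, and `P * K_b` is expanded by means of an identity for
`∑_c x_c * e_a(x ∖ x_c) * e_b(x ∖ {x_c, x_z})`.
-/

namespace ChromSymm

open Finset

section ElementarySymmetric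

open PowerSeries (C X coeff)

variable {σ R : Type*} [CommRing R] (x : σ → R)

/-- The elementary symmetric polynomial `e_k` of the family of elements `x i` with `i ∈ S`. -/
def esymmOn (S : Finset σ) (k : ℕ) : R := (S.val.map x).esymm k

/-- The generating function `∑ e_k X ^ k` of the elementary symmetric polynomials on `S`, as the
product `∏ (1 + x i * X)`. -/
noncomputable def esymmGen (S : Finset σ) : PowerSeries R := ∏ i ∈ S, (1 + C (x i) * X)

lemma esymmOn_eq_sum (S : Finset σ) (k : ℕ) :
    esymmOn x S k = ∑ T ∈ S.powersetCard k, ∏ i ∈ T, x i :=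
  Finset.esymm_map_val x S k

lemma esymmOn_zero (S : Finset σ) : esymmOn x S 0 = 1 := by
  rw [esymmOn_eq_sum, powersetCard_zero, sum_singleton, prod_empty]

lemma esymmOn_eq_zero_of_card_lt {S : Finset σ} {k : ℕ} (h : #S < k) : esymmOn x S k = 0 := by
  rw [esymmOn_eq_sum, powersetCard_eq_empty.2 h, sum_empty]

lemma coeff_esymmGen (S : Finset σ) (k : ℕ) : coeff k (esymmGen x S) = esymmOn x S k := by
  classical
  simp only [esymmGen, prod_one_add, prod_mul_distrib, prod_const, map_sum, ← map_prod,
    PowerSeries.coeff_C_mul, PowerSeries.coeff_X_pow, mul_ite, mul_one, mul_zero,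
    ← sum_filter, esymmOn_eq_sum, powersetCard_eq_filter, eq_comm (a := k)]

lemma prod_sub_eq_sum_esymmOn (S : Finset σ) (y : R) :
    ∏ i ∈ S, (y - x i) = ∑ k ∈ range (#S + 1), (-1) ^ k * (esymmOn x S k * y ^ (#S - k)) := by
  have h := congrArg (Polynomial.eval y) (Multiset.prod_X_sub_X_eq_sum_esymm (S.val.map x))
  simpa [Polynomial.eval_finsetSum, Polynomial.eval_prod, esymmOn] using h

variable [DecidableEq σ]

lemma esymmGen_erase {S : Finset σ} {c : σ} (hc : c ∈ S) :
    esymmGen x S = (1 + C (x c) * X) * esymmGen x (S.erase c) :=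
  (mul_prod_erase S (fun i => 1 + C (x i) * X) hc).symm

lemma esymmOn_succ {S : Finset σ} {c : σ} (hc : c ∈ S) (k : ℕ) :
    esymmOn x S (k + 1) = esymmOn x (S.erase c) (k + 1) + x c * esymmOn x (S.erase c) k := by
  rw [← coeff_esymmGen, esymmGen_erase x hc, add_mul, one_mul, map_add, mul_assoc,
    PowerSeries.coeff_C_mul, PowerSeries.coeff_succ_X_mul, coeff_esymmGen, coeff_esymmGen]

lemma sum_mul_esymmOn_erase (S : Finset σ) (k : ℕ) :
    ∑ c ∈ S, x c * esymmOn x (S.erase c) k = (k + 1) * esymmOn x S (k + 1) := by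
  induction S using Finset.induction_on generalizing k with
  | empty => rw [sum_empty, esymmOn_eq_zero_of_card_lt x (by simp), mul_zero]
  | insert d S hd ih =>
    have erase_insert_of_mem : ∀ c ∈ S, (insert d S).erase c = insert d (S.erase c) := fun c hc =>
      erase_insert_of_ne (ne_of_mem_of_not_mem hc hd).symm
    have esymmOn_insert : ∀ T ⊆ S, ∀ j,
        esymmOn x (insert d T) (j + 1) = esymmOn x T (j + 1) + x d * esymmOn x T j := by
      intro T hT j
      rw [esymmOn_succ x (mem_insert_self d T), erase_insert fun h => hd (hT h)]
    rw [sum_insert hd, erase_insert hd, esymmOn_insert S subset_rfl,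
      sum_congr rfl fun c hc => by rw [erase_insert_of_mem c hc]]
    cases k with
    | zero =>
      have := ih 0
      simp only [esymmOn_zero] at this ⊢
      rw [this]
      ring
    | succ k =>
      rw [sum_congr rfl fun c _ => by rw [esymmOn_insert _ (erase_subset c S), mul_add,
        mul_left_comm], sum_add_distrib, ← mul_sum, ih, ih]
      push_cast
      ring

end ElementarySymmetric

section CliqueIdentity

variable {R : Type*} [CommRing R]

lemma sum_range_mul_sub_sum_range_mul {t : R} {e f : ℕ → R} (h₀ : e 0 = f 0)
    (hsucc : ∀ j, e (j + 1) = f (j + 1) + t * f j) (a b : ℕ) :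
    ∑ i ∈ range (b + 2), e (b + 1 - i) * f (a + 1 + i) -
      ∑ j ∈ range (b + 1), e (a + b + 2 - j) * f j = f (a + 1) * f (b + 1) := by
  induction b generalizing a with
  | zero =>
    simp only [sum_range_succ, sum_range_zero, hsucc, h₀, Nat.sub_self, Nat.sub_zero, add_zero,
      zero_add]
    ring
  | succ b ih =>
    have h := ih (a + 1)
    have shift : ∀ i, e (b + 1 + 1 - (i + 1)) * f (a + 1 + (i + 1)) =
        e (b + 1 - i) * f (a + 1 + 1 + i) := fun i => by
      rw [Nat.add_sub_add_right, add_assoc (a + 1), add_comm 1 i]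
    rw [show a + (b + 1) + 2 = a + 1 + b + 2 by omega, sum_range_succ',
      sum_range_succ fun j => e (a + 1 + b + 2 - j) * f j, sum_congr rfl fun i _ => shift i,
      show a + 1 + b + 2 - (b + 1) = a + 1 + 1 by omega, Nat.sub_zero, add_zero, hsucc (b + 1),
      hsucc (a + 1)]
    linear_combination h

/-- The multiplicity of `e_{a+b+1-j}(S) e_j(S ∖ z)` in the sum over `c ∈ S ∖ z` of
`x_c e_a(S ∖ c) e_b(S ∖ {z, c})`. The subtractions are truncated. -/
def cliqueWeight (a b j : ℕ) : ℕ := if j ≤ b then a - j else j - a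

lemma cliqueWeight_eq_add (a b j : ℕ) :
    (cliqueWeight a b j : ℤ) = (j - a : ℕ) + if j ≤ b then (a - j : ℤ) else 0 := by
  unfold cliqueWeight
  split_ifs <;> omega

lemma sum_cliqueWeight_mul (a b : ℕ) (g : ℕ → R) :
    ∑ j ∈ range (a + b + 2), cliqueWeight a b j * g j =
      ∑ i ∈ range (b + 1), (i + 1) * g (a + 1 + i) + ∑ j ∈ range (b + 1), (a - j) * g j := by
  have weight_eq : ∀ j, (cliqueWeight a b j : R) * g j =
      (j - a : ℕ) * g j + if j ≤ b then (a - j) * g j else 0 := fun j => by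
    have h := congrArg (Int.cast (R := R)) (cliqueWeight_eq_add a b j)
    push_cast at h
    rw [h, add_mul, ite_mul, zero_mul]
  rw [sum_congr rfl fun j _ => weight_eq j, sum_add_distrib]
  congr 1
  · rw [show a + b + 2 = a + 1 + (b + 1) by omega, sum_range_add, sum_eq_zero, zero_add]
    · refine sum_congr rfl fun i _ => ?_
      rw [show a + 1 + i - a = i + 1 by omega, Nat.cast_succ]
    · intro j hj
      rw [Nat.sub_eq_zero_of_le (Nat.lt_succ_iff.1 (mem_range.1 hj)), Nat.cast_zero, zero_mul]
  · rw [← sum_filter]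
    refine sum_congr ?_ fun _ _ => rfl
    ext j
    simp only [mem_filter, mem_range]
    omega

variable {σ : Type*} [DecidableEq σ] (x : σ → R) {S : Finset σ} {z : σ}

lemma sum_mul_esymmOn_erase_mul_esymmOn_erase_succ (hz : z ∈ S) (a b : ℕ) :
    ∑ c ∈ S.erase z, x c * (esymmOn x (S.erase c) a * esymmOn x ((S.erase z).erase c) (b + 1)) =
      ∑ c ∈ S.erase z, x c * (esymmOn x (S.erase c) (a + 1) * esymmOn x ((S.erase z).erase c) b) +
        (a - b - 1) * (esymmOn x S (a + 1) * esymmOn x (S.erase z) (b + 1)) +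
        esymmOn x (S.erase z) (a + 1) * esymmOn x (S.erase z) (b + 1) := by
  have hS : ∑ c ∈ S.erase z, x c * esymmOn x (S.erase c) a =
      a * esymmOn x S (a + 1) + esymmOn x (S.erase z) (a + 1) := by
    have h := sum_mul_esymmOn_erase x S a
    rw [← add_sum_erase _ _ hz] at h
    linear_combination h + esymmOn_succ x hz a
  have hSz := sum_mul_esymmOn_erase x (S.erase z) b
  have swap : ∀ c ∈ S.erase z,
      x c * (esymmOn x (S.erase c) a * esymmOn x ((S.erase z).erase c) (b + 1)) =
        x c * (esymmOn x (S.erase c) (a + 1) * esymmOn x ((S.erase z).erase c) b) +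
        x c * esymmOn x (S.erase c) a * esymmOn x (S.erase z) (b + 1) -
        x c * esymmOn x ((S.erase z).erase c) b * esymmOn x S (a + 1) := by
    intro c hc
    rw [esymmOn_succ x hc b, esymmOn_succ x (mem_of_mem_erase hc) a]
    ring
  rw [sum_congr rfl swap, sum_sub_distrib, sum_add_distrib, ← sum_mul, ← sum_mul, hS, hSz]
  ring

lemma sum_mul_esymmOn_erase_mul_esymmOn_erase_eq_add (hz : z ∈ S) (a b : ℕ) :
    ∑ c ∈ S.erase z, x c * (esymmOn x (S.erase c) a * esymmOn x ((S.erase z).erase c) b) =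
      ∑ i ∈ range (b + 1), (i + 1) * (esymmOn x S (b - i) * esymmOn x (S.erase z) (a + 1 + i)) +
        ∑ j ∈ range (b + 1), (a - j) * (esymmOn x S (a + b + 1 - j) * esymmOn x (S.erase z) j) := by
  induction b generalizing a with
  | zero =>
    have h := sum_mul_esymmOn_erase x S a
    rw [← add_sum_erase _ _ hz] at h
    simp only [esymmOn_zero, mul_one, zero_add, sum_range_one, Nat.sub_zero, Nat.cast_zero,
      sub_zero, add_zero, one_mul]
    linear_combination h + esymmOn_succ x hz a
  | succ b ih =>
    have telescope := sum_range_mul_sub_sum_range_mul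
      ((esymmOn_zero x S).trans (esymmOn_zero x (S.erase z)).symm) (esymmOn_succ x hz) a b
    have shift : ∀ i, esymmOn x S (b + 1 - (i + 1)) * esymmOn x (S.erase z) (a + 1 + (i + 1)) =
        esymmOn x S (b - i) * esymmOn x (S.erase z) (a + 1 + 1 + i) := fun i => by
      rw [Nat.add_sub_add_right, add_assoc (a + 1), add_comm 1 i]
    rw [sum_range_succ'] at telescope ⊢
    rw [sum_mul_esymmOn_erase_mul_esymmOn_erase_succ x hz, ih, sum_range_succ _ (b + 1),
      show a + (b + 1) + 1 - (b + 1) = a + 1 by omega, show a + 1 + b + 1 = a + b + 2 by omega]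
    simp only [shift, Nat.cast_add, Nat.cast_one, add_mul, sub_mul, one_mul, sum_add_distrib,
      sum_sub_distrib] at telescope ⊢
    linear_combination -telescope

lemma sum_mul_esymmOn_erase_mul_esymmOn_erase (hz : z ∈ S) (a b : ℕ) :
    ∑ c ∈ S.erase z, x c * (esymmOn x (S.erase c) a * esymmOn x ((S.erase z).erase c) b) =
      ∑ j ∈ range (a + b + 2),
        cliqueWeight a b j * (esymmOn x S (a + b + 1 - j) * esymmOn x (S.erase z) j) := by
  rw [sum_mul_esymmOn_erase_mul_esymmOn_erase_eq_add x hz, sum_cliqueWeight_mul]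
  simp only [show ∀ i, a + b + 1 - (a + 1 + i) = b - i by omega]

end CliqueIdentity

lemma coeff_invOfUnit_one_mem {R S : Type*} [CommRing R] [SetLike S R] [SubsemiringClass S R]
    {s : S} {f : PowerSeries R} (h : ∀ k, -PowerSeries.coeff (k + 1) f ∈ s) (k : ℕ) :
    PowerSeries.coeff k (f.invOfUnit 1) ∈ s := by
  induction k using Nat.strong_induction_on with
  | _ k ih =>
    rw [PowerSeries.coeff_invOfUnit]
    split_ifs with hk
    · simp
    · rw [inv_one, Units.val_one, neg_one_mul, ← sum_neg_distrib]
      refine sum_mem fun p hp => ?_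
      rw [HasAntidiagonal.mem_antidiagonal] at hp
      split_ifs with hlt
      · obtain ⟨i, hi⟩ := Nat.exists_eq_succ_of_ne_zero (show p.1 ≠ 0 by omega)
        rw [hi, ← neg_mul]
        exact mul_mem (h i) (ih _ hlt)
      · simp

/-- The `e`-positive elements: the polynomials in the elementary symmetric polynomials of the
family `x` with coefficients in `ℕ`. -/
def ePos {σ R : Type*} [Fintype σ] [CommRing R] (x : σ → R) : Subalgebra ℕ R :=
  Algebra.adjoin ℕ (Set.range (esymmOn x univ))

lemma esymmOn_univ_mem_ePos {σ R : Type*} [Fintype σ] [CommRing R] (x : σ → R) (k : ℕ) :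
    esymmOn x univ k ∈ ePos x :=
  Algebra.subset_adjoin ⟨k, rfl⟩

section Walks

open PowerSeries (C X coeff)
open scoped Matrix

variable {σ R : Type*} [DecidableEq σ] [CommRing R]

variable (σ R) in
/-- The matrix recording that two adjacent vertices have distinct colours. -/
abbrev offDiag : Matrix σ σ R := (⊤ : SimpleGraph σ).adjMatrix R

lemma offDiag_apply (c z : σ) : offDiag σ R c z = if c = z then 0 else 1 := by
  simp only [SimpleGraph.adjMatrix_apply, SimpleGraph.top_adj, ne_eq, ite_not]

variable [Fintype σ] (x : σ → R)

/-- The transfer matrix of an edge, weighted by the colour of its second endpoint. -/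
def step : Matrix σ σ R := offDiag σ R * Matrix.diagonal x

/-- The transfer matrix of a path with `l` inner vertices whose endpoints are joined by a chord,
weighted by the colours of all its vertices except the first. -/
def ear (l : ℕ) : Matrix σ σ R := (step x ^ (l + 1)) ⊙ offDiag σ R

/-- The series `E - X E'`, where `E` is the generating function of the elementary symmetric
polynomials: the common denominator of the generating functions of walks between colours. -/
noncomputable def walkDenom : PowerSeries R :=
  esymmGen x univ - X * ∑ c, C (x c) * esymmGen x (univ.erase c)

/-- The numerator of the generating function of walks from the colour `c` to the colour `z`. -/
noncomputable def walkNumer (c z : σ) : PowerSeries R :=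
  if c = z then X * ∑ u ∈ univ.erase z, C (x u) * esymmGen x ((univ.erase z).erase u)
  else esymmGen x ((univ.erase z).erase c)

lemma step_apply (c z : σ) : step x c z = offDiag σ R c z * x z := Matrix.mul_diagonal _ _ _ _

lemma step_mul_apply (M : Matrix σ σ R) (c z : σ) :
    (step x * M) c z = ∑ u ∈ univ.erase c, x u * M u z := by
  rw [Matrix.mul_apply, ← add_sum_erase _ _ (mem_univ c), step_apply, offDiag_apply, if_pos rfl,
    zero_mul, zero_mul, zero_add]
  refine sum_congr rfl fun u hu => ?_
  rw [step_apply, offDiag_apply, if_neg (ne_of_mem_erase hu).symm, one_mul]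

lemma ear_zero : ear x 0 = step x := by
  ext c z
  rw [ear, zero_add, pow_one, Matrix.hadamard_apply, step_apply, offDiag_apply]
  split_ifs <;> simp

lemma coeff_walkDenom (k : ℕ) :
    coeff k (walkDenom x) = esymmOn x univ k - k * esymmOn x univ k := by
  cases k with
  | zero =>
    rw [walkDenom, map_sub, PowerSeries.coeff_zero_X_mul, coeff_esymmGen, Nat.cast_zero, zero_mul]
  | succ k =>
    simp only [walkDenom, map_sub, map_sum, PowerSeries.coeff_succ_X_mul, PowerSeries.coeff_C_mul,
      coeff_esymmGen, sum_mul_esymmOn_erase, Nat.cast_succ]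

lemma walkDenom_mul_invOfUnit : walkDenom x * (walkDenom x).invOfUnit 1 = 1 := by
  refine PowerSeries.mul_invOfUnit _ _ ?_
  rw [← PowerSeries.coeff_zero_eq_constantCoeff_apply, coeff_walkDenom, esymmOn_zero]
  simp

lemma coeff_invOfUnit_walkDenom_mem_ePos (k : ℕ) :
    coeff k ((walkDenom x).invOfUnit 1) ∈ ePos x := by
  refine coeff_invOfUnit_one_mem (fun k => ?_) k
  have h : -coeff (k + 1) (walkDenom x) = k * esymmOn x univ (k + 1) := by
    rw [coeff_walkDenom]
    push_cast
    ring
  rw [h]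
  exact mul_mem (natCast_mem _ k) (esymmOn_univ_mem_ePos x _)

lemma walkDenom_eq (z : σ) :
    walkDenom x = esymmGen x (univ.erase z) - X * ((1 + C (x z) * X) *
      ∑ u ∈ univ.erase z, C (x u) * esymmGen x ((univ.erase z).erase u)) := by
  have factor : ∀ u ∈ univ.erase z, C (x u) * esymmGen x (univ.erase u) =
      (1 + C (x z) * X) * (C (x u) * esymmGen x ((univ.erase z).erase u)) := fun u hu => by
    rw [esymmGen_erase x (mem_erase.2 ⟨(ne_of_mem_erase hu).symm, mem_univ z⟩), erase_right_comm,
      mul_left_comm]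
  rw [walkDenom, ← add_sum_erase _ _ (mem_univ z), sum_congr rfl factor, ← mul_sum,
    esymmGen_erase x (mem_univ z)]
  ring

lemma walkNumer_eq (c z : σ) :
    walkNumer x c z = walkDenom x * (if c = z then 0 else 1) +
      X * ∑ u ∈ univ.erase c, C (x u) * walkNumer x u z := by
  have off : ∀ u ∈ univ.erase z, C (x u) * walkNumer x u z =
      C (x u) * esymmGen x ((univ.erase z).erase u) := fun u hu => by
    rw [walkNumer, if_neg (ne_of_mem_erase hu)]
  by_cases h : c = z
  · rw [h, sum_congr rfl off, if_pos rfl, walkNumer, if_pos rfl, mul_zero, zero_add]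
  · have hc : c ∈ univ.erase z := mem_erase.2 ⟨h, mem_univ c⟩
    rw [sum_erase_eq_sub (mem_univ c), ← add_sum_erase _ _ (mem_univ z), sum_congr rfl off,
      off c hc, if_neg h, walkDenom_eq x z, esymmGen_erase x hc]
    simp only [walkNumer, if_neg h, if_pos]
    ring

lemma invOfUnit_walkDenom_mul_walkNumer (c z : σ) :
    (walkDenom x).invOfUnit 1 * walkNumer x c z = (if c = z then 0 else 1) +
      X * ∑ u ∈ univ.erase c, C (x u) * ((walkDenom x).invOfUnit 1 * walkNumer x u z) := by
  rw [walkNumer_eq, mul_add, ← mul_assoc, mul_comm _ (walkDenom x), walkDenom_mul_invOfUnit,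
    one_mul, mul_left_comm, mul_sum]
  simp only [mul_left_comm]

lemma step_pow_succ_apply (l : ℕ) (c z : σ) :
    (step x ^ (l + 1)) c z = x z * coeff l ((walkDenom x).invOfUnit 1 * walkNumer x c z) := by
  induction l generalizing c with
  | zero =>
    rw [zero_add, pow_one, step_apply, offDiag_apply, invOfUnit_walkDenom_mul_walkNumer, map_add,
      PowerSeries.coeff_zero_X_mul, add_zero, mul_comm]
    split_ifs <;> simp
  | succ l ih =>
    have coeff_ite : coeff (l + 1) (if c = z then 0 else 1 : PowerSeries R) = 0 := by
      split_ifs <;> simp [PowerSeries.coeff_one]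
    rw [pow_succ', step_mul_apply, invOfUnit_walkDenom_mul_walkNumer, map_add, coeff_ite, zero_add,
      PowerSeries.coeff_succ_X_mul, map_sum, mul_sum]
    refine sum_congr rfl fun u _ => ?_
    rw [ih, PowerSeries.coeff_C_mul, mul_left_comm]

/-- The coloured cliques with `b` vertices besides the two whose colours are recorded; the
second of these counts in the weight, and the order of the `b` others is disregarded. -/
def clique (b : ℕ) : Matrix σ σ R :=
  Matrix.of fun c z => if c = z then 0 else x z * esymmOn x ((univ.erase z).erase c) b

lemma ear_eq_sum_smul_clique (l : ℕ) :
    ear x l = ∑ p ∈ antidiagonal l, coeff p.1 ((walkDenom x).invOfUnit 1) • clique x p.2 := by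
  ext c z
  rw [ear, Matrix.hadamard_apply, step_pow_succ_apply, offDiag_apply, Matrix.sum_apply]
  simp only [Matrix.smul_apply, clique, Matrix.of_apply, smul_eq_mul]
  split_ifs with h
  · simp
  · rw [walkNumer, if_neg h, PowerSeries.coeff_mul, mul_one, mul_sum]
    simp only [coeff_esymmGen, mul_left_comm]

end Walks

lemma trace_eq_trace_of_mul_eq_mul {n R : Type*} [Fintype n] [DecidableEq n] [CommRing R]
    [IsDomain R] {P Z M : Matrix n n R} (hP : P.det ≠ 0) (h : P * Z = M * P) :
    Z.trace = M.trace := by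
  refine mul_left_cancel₀ hP ?_
  calc P.det * Z.trace = (P.adjugate * (P * Z)).trace := by
        rw [← Matrix.mul_assoc, Matrix.adjugate_mul, Matrix.smul_mul, Matrix.one_mul,
          Matrix.trace_smul, smul_eq_mul]
    _ = (M * (P * P.adjugate)).trace := by rw [h, Matrix.trace_mul_comm, Matrix.mul_assoc]
    _ = P.det * M.trace := by
        rw [Matrix.mul_adjugate, Matrix.mul_smul, Matrix.mul_one, Matrix.trace_smul, smul_eq_mul]

section EPosMatrices

variable {N : ℕ} {R : Type*} [CommRing R] (x : Fin N → R)

/-- The matrix with entries `x_c e_a(x ∖ x_c)`, which conjugates the transfer matrices into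
matrices with `e`-positive entries. -/
def markedEsymm : Matrix (Fin N) (Fin N) R :=
  Matrix.of fun a c => x c * esymmOn x (univ.erase c) a

lemma vandermonde_mul_markedEsymm :
    (Matrix.of fun d a : Fin N => (-1) ^ (a : ℕ) * x d ^ (N - 1 - a)) * markedEsymm x =
      Matrix.diagonal fun c => x c * ∏ i ∈ univ.erase c, (x c - x i) := by
  ext d c
  have hcard : #(univ.erase c) + 1 = N := by
    rw [card_erase_add_one (mem_univ c), card_fin]
  have expand : x c * ∏ i ∈ univ.erase c, (x d - x i) =
      ∑ a : Fin N, (-1) ^ (a : ℕ) * x d ^ (N - 1 - a) * (x c * esymmOn x (univ.erase c) a) := by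
    rw [prod_sub_eq_sum_esymmOn, hcard, sum_range, mul_sum]
    refine sum_congr rfl fun a _ => ?_
    rw [show #(univ.erase c) = N - 1 by omega]
    ring
  rw [Matrix.mul_apply, Matrix.diagonal_apply]
  simp only [Matrix.of_apply, markedEsymm, ← expand]
  split_ifs with h
  · rw [h]
  · rw [prod_eq_zero (mem_erase.2 ⟨h, mem_univ d⟩) (sub_self _), mul_zero]

lemma det_markedEsymm_ne_zero [IsDomain R] (hinj : Function.Injective x) (h₀ : ∀ c, x c ≠ 0) :
    (markedEsymm x).det ≠ 0 := by
  have hdet := congrArg Matrix.det (vandermonde_mul_markedEsymm x)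
  rw [Matrix.det_mul, Matrix.det_diagonal] at hdet
  have hne : ∏ c, x c * ∏ i ∈ univ.erase c, (x c - x i) ≠ 0 :=
    prod_ne_zero_iff.2 fun c _ => mul_ne_zero (h₀ c) <| prod_ne_zero_iff.2 fun i hi =>
      sub_ne_zero.2 fun h => ne_of_mem_erase hi (hinj h).symm
  rw [← hdet] at hne
  exact right_ne_zero_of_mul hne

/-- The matrices `Z` over the colours which become `e`-positive after the change of basis
`markedEsymm x`; as that matrix need not be invertible, this is expressed by an intertwining
relation. -/
def ePosMatrices : Subalgebra (ePos x) (Matrix (Fin N) (Fin N) R) where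
  carrier := {Z | ∃ M ∈ (ePos x).matrix, markedEsymm x * Z = M * markedEsymm x}
  mul_mem' := by
    rintro Z Z' ⟨M, hM, h⟩ ⟨M', hM', h'⟩
    exact ⟨M * M', mul_mem hM hM', by
      rw [← Matrix.mul_assoc, h, Matrix.mul_assoc, h', Matrix.mul_assoc]⟩
  add_mem' := by
    rintro Z Z' ⟨M, hM, h⟩ ⟨M', hM', h'⟩
    exact ⟨M + M', add_mem hM hM', by rw [Matrix.mul_add, Matrix.add_mul, h, h']⟩
  algebraMap_mem' r := ⟨algebraMap (ePos x) _ r, fun i j => by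
    rw [Matrix.algebraMap_matrix_apply]
    split_ifs
    exacts [r.2, zero_mem _], (Algebra.commutes r _).symm⟩

lemma trace_mem_ePos [IsDomain R] (hinj : Function.Injective x) (h₀ : ∀ c, x c ≠ 0)
    {Z : Matrix (Fin N) (Fin N) R} (hZ : Z ∈ ePosMatrices x) : Z.trace ∈ ePos x := by
  obtain ⟨M, hM, h⟩ := hZ
  rw [trace_eq_trace_of_mul_eq_mul (det_markedEsymm_ne_zero x hinj h₀) h]
  exact sum_mem fun i _ => hM i i

lemma markedEsymm_mul_clique_apply (b : ℕ) (a z : Fin N) :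
    (markedEsymm x * clique x b) a z = ∑ j ∈ range (a + b + 2),
      cliqueWeight a b j * esymmOn x univ (a + b + 1 - j) *
        (x z * esymmOn x (univ.erase z) j) := by
  calc (markedEsymm x * clique x b) a z = x z * ∑ c ∈ univ.erase z,
        x c * (esymmOn x (univ.erase c) a * esymmOn x ((univ.erase z).erase c) b) := by
        rw [Matrix.mul_apply, ← add_sum_erase _ _ (mem_univ z), mul_sum]
        simp only [clique, markedEsymm, Matrix.of_apply, if_true, mul_zero, zero_add]
        refine sum_congr rfl fun c hc => ?_
        rw [if_neg (ne_of_mem_erase hc)]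
        ring
    _ = _ := by
        rw [sum_mul_esymmOn_erase_mul_esymmOn_erase x (mem_univ z), mul_sum]
        exact sum_congr rfl fun j _ => by ring

lemma clique_mem_ePosMatrices (b : ℕ) : clique x b ∈ ePosMatrices x := by
  let coeff (a j : ℕ) : R := cliqueWeight a b j * esymmOn x univ (a + b + 1 - j)
  refine ⟨Matrix.of fun a j : Fin N => if (j : ℕ) < a + b + 2 then coeff a j else 0,
    fun a j => ?_, ?_⟩
  · change ite _ _ _ ∈ ePos x
    split_ifs
    · exact mul_mem (natCast_mem _ _) (esymmOn_univ_mem_ePos x _)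
    · exact zero_mem _
  · ext a z
    have vanish : ∀ j, N ≤ j → esymmOn x (univ.erase z) j = 0 := fun j hj =>
      esymmOn_eq_zero_of_card_lt x <|
        (card_erase_lt_of_mem (mem_univ z)).trans_le ((card_fin N).trans_le hj)
    rw [markedEsymm_mul_clique_apply, Matrix.mul_apply]
    simp only [Matrix.of_apply, markedEsymm, ite_mul, zero_mul]
    rw [← sum_range fun j : ℕ => if j < (a : ℕ) + b + 2 then
      coeff a j * (x z * esymmOn x (univ.erase z) j) else 0, ← sum_filter]
    refine (sum_subset_zero_on_sdiff (fun j hj => mem_range.2 (mem_filter.1 hj).2)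
      (fun j hj => ?_) fun j _ => rfl).symm
    rw [mem_sdiff, mem_filter, mem_range, mem_range] at hj
    rw [vanish j (by omega), mul_zero, mul_zero]

lemma ear_mem_ePosMatrices (l : ℕ) : ear x l ∈ ePosMatrices x := by
  rw [ear_eq_sum_smul_clique]
  exact sum_mem fun p _ => (ePosMatrices x).smul_mem (clique_mem_ePosMatrices x p.2)
    (⟨_, coeff_invOfUnit_walkDenom_mem_ePos x p.1⟩ : ePos x)

lemma step_mem_ePosMatrices : step x ∈ ePosMatrices x :=
  ear_zero x ▸ ear_mem_ePosMatrices x 0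

end EPosMatrices

section Transfer

open scoped Matrix

variable {σ R : Type*}

lemma extend_snoc (ω : ℕ → σ) {j : ℕ} (κ : Fin j → σ) (c : σ) :
    Function.extend Fin.val (Fin.snoc (α := fun _ => σ) κ c) ω =
      Function.update (Function.extend Fin.val κ ω) j c := by
  have extend_val {j : ℕ} (κ : Fin j → σ) (v : Fin j) : Function.extend Fin.val κ ω v = κ v :=
    Fin.val_injective.extend_apply κ ω v
  funext i
  rcases lt_trichotomy i j with h | rfl | h
  · rw [Function.update_of_ne h.ne]
    exact (extend_val _ (Fin.castSucc ⟨i, h⟩)).trans <|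
      (Fin.snoc_castSucc ..).trans (extend_val κ ⟨i, h⟩).symm
  · rw [Function.update_self]
    exact (extend_val _ (Fin.last i)).trans (Fin.snoc_last ..)
  · rw [Function.update_of_ne h.ne', Function.extend_apply' _ _ _ (by rintro ⟨v, rfl⟩; omega),
      Function.extend_apply' _ _ _ (by rintro ⟨v, rfl⟩; omega)]

variable [CommRing R]

lemma dependsOn_prod_range (T : σ → σ → R) (j l : ℕ) :
    DependsOn (fun κ : ℕ → σ => ∏ i ∈ range l, T (κ (j + i)) (κ (j + i + 1)))
      (Set.Iic (j + l)) := by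
  intro κ κ' hκ
  refine prod_congr rfl fun i hi => ?_
  rw [mem_range] at hi
  rw [hκ (j + i) (Set.mem_Iic.2 (by omega)), hκ (j + i + 1) (Set.mem_Iic.2 (by omega))]

variable [Fintype σ] (ω : ℕ → σ)

/-- The sum of `Φ` over all sequences of colours that agree with `ω` from the index `j` on. -/
noncomputable def sumColors (j : ℕ) (Φ : (ℕ → σ) → R) : R :=
  ∑ κ : Fin j → σ, Φ (Function.extend Fin.val κ ω)

/-- Summing over the colours of the vertices `0, …, j` with the weight `W` amounts to taking the
trace of `Z`, the colours of the vertices `j` and `0` being linked by an arbitrary matrix. -/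
structure IsTransfer (j : ℕ) (W : (ℕ → σ) → R) (Z : Matrix σ σ R) : Prop where
  dependsOn : DependsOn W (Set.Iic j)
  sumColors_mul : ∀ Y : Matrix σ σ R,
    sumColors ω (j + 1) (fun κ => W κ * Y (κ j) (κ 0)) = (Z * Y).trace

variable {ω}

lemma sumColors_succ (j : ℕ) (Φ : (ℕ → σ) → R) :
    sumColors ω (j + 1) Φ = sumColors ω j fun κ => ∑ c, Φ (Function.update κ j c) := by
  rw [sumColors, sumColors, ← (Fin.snocEquiv fun _ => σ).sum_comp, Fintype.sum_prod_type, sum_comm]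
  exact sum_congr rfl fun κ _ => sum_congr rfl fun c _ => congrArg Φ (extend_snoc ω κ c)

lemma sumColors_succ_of_dependsOn {j : ℕ} {h : (ℕ → σ) → σ → R} (hh : DependsOn h (Set.Iio j)) :
    sumColors ω (j + 1) (fun κ => h κ (κ j)) = sumColors ω j fun κ => ∑ c, h κ c := by
  rw [sumColors_succ]
  congr 1
  funext κ
  refine sum_congr rfl fun c _ => ?_
  rw [hh fun i hi => Function.update_of_ne (ne_of_lt hi) c κ, Function.update_self]

variable [DecidableEq σ] {j : ℕ}

lemma sumColors_prod_mul (T : Matrix σ σ R) {h : (ℕ → σ) → σ → R}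
    (hh : DependsOn h (Set.Iic j)) (l : ℕ) :
    sumColors ω (j + l + 1)
      (fun κ => (∏ i ∈ range l, T (κ (j + i)) (κ (j + i + 1))) * h κ (κ (j + l))) =
    sumColors ω (j + 1) fun κ => ((T ^ l).mulVec (h κ)) (κ j) := by
  induction l generalizing h with
  | zero => simp
  | succ l ih =>
    have hlast : DependsOn (fun κ c => (∏ i ∈ range l, T (κ (j + i)) (κ (j + i + 1))) *
        (T (κ (j + l)) c * h κ c)) (Set.Iio (j + l + 1)) := fun κ κ' hκ => by
      have agree : ∀ i ≤ j + l, κ i = κ' i := fun i hi => hκ i (Nat.lt_succ_of_le hi)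
      simp only [dependsOn_prod_range T j l agree, agree (j + l) le_rfl,
        hh fun i hi => agree i (le_add_right hi)]
    calc _ = sumColors ω (j + l + 1) fun κ => ∑ c,
          (∏ i ∈ range l, T (κ (j + i)) (κ (j + i + 1))) * (T (κ (j + l)) c * h κ c) := by
          rw [← sumColors_succ_of_dependsOn hlast]
          simp only [prod_range_succ, ← add_assoc, mul_assoc]
      _ = sumColors ω (j + l + 1) fun κ =>
          (∏ i ∈ range l, T (κ (j + i)) (κ (j + i + 1))) * T.mulVec (h κ) (κ (j + l)) := by
          simp only [← mul_sum, Matrix.mulVec, dotProduct]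
      _ = _ := by
          rw [ih fun κ κ' hκ => congrArg T.mulVec (hh hκ)]
          simp only [Matrix.mulVec_mulVec, pow_succ]

namespace IsTransfer

lemma zero : IsTransfer ω 0 (fun _ => (1 : R)) 1 where
  dependsOn := fun _ _ _ => rfl
  sumColors_mul Y := by
    rw [sumColors_succ]
    simp [sumColors, Matrix.trace]

variable {W : (ℕ → σ) → R} {Z : Matrix σ σ R}

lemma hadamard (hW : IsTransfer ω j W Z) (T U : Matrix σ σ R) (l : ℕ) :
    IsTransfer ω (j + l) (fun κ => W κ * (∏ i ∈ range l, T (κ (j + i)) (κ (j + i + 1))) *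
      U (κ j) (κ (j + l))) (Z * ((T ^ l) ⊙ U)) where
  dependsOn κ κ' hκ := by
    have agree : ∀ i ≤ j + l, κ i = κ' i := hκ
    simp only [dependsOn_prod_range T j l agree, agree j le_self_add, agree (j + l) le_rfl,
      hW.dependsOn fun i hi => agree i (le_add_right hi)]
  sumColors_mul Y := by
    have hh : DependsOn (fun κ z => W κ * U (κ j) z * Y z (κ 0)) (Set.Iic j) := fun κ κ' hκ => by
      have agree : ∀ i ≤ j, κ i = κ' i := hκ
      simp only [hW.dependsOn hκ, agree j le_rfl, agree 0 (Nat.zero_le j)]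
    calc _ = sumColors ω (j + l + 1) fun κ => (∏ i ∈ range l, T (κ (j + i)) (κ (j + i + 1))) *
          (W κ * U (κ j) (κ (j + l)) * Y (κ (j + l)) (κ 0)) := by
          congr 1
          funext κ
          ring
      _ = sumColors ω (j + 1) fun κ => W κ * (((T ^ l) ⊙ U) * Y) (κ j) (κ 0) := by
          rw [sumColors_prod_mul T hh]
          simp only [Matrix.mulVec, dotProduct, Matrix.mul_apply, Matrix.hadamard_apply, mul_sum]
          congr 1
          funext κ
          exact sum_congr rfl fun z _ => by ring
      _ = _ := by rw [Matrix.mul_assoc, hW.sumColors_mul]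

lemma prod_range (hW : IsTransfer ω j W Z) (T : Matrix σ σ R) (l : ℕ) :
    IsTransfer ω (j + l) (fun κ => W κ * ∏ i ∈ range l, T (κ (j + i)) (κ (j + i + 1)))
      (Z * T ^ l) := by
  simpa only [Matrix.of_apply, Pi.one_apply, mul_one, Matrix.hadamard_of_one] using
    hW.hadamard T (Matrix.of 1) l

lemma sumColors_cycle (hW : IsTransfer ω j W Z) (T U : Matrix σ σ R) (l : ℕ) :
    sumColors ω (j + l + 1) (fun κ => W κ * (∏ i ∈ range l, T (κ (j + i)) (κ (j + i + 1))) *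
      T (κ (j + l)) (κ 0) * U (κ j) (κ 0)) = (Z * ((T ^ (l + 1)) ⊙ U)).trace := by
  have hh : DependsOn (fun κ z => W κ * U (κ j) (κ 0) * T z (κ 0)) (Set.Iic j) := fun κ κ' hκ => by
    have agree : ∀ i ≤ j, κ i = κ' i := hκ
    simp only [hW.dependsOn hκ, agree j le_rfl, agree 0 (Nat.zero_le j)]
  calc _ = sumColors ω (j + l + 1) fun κ => (∏ i ∈ range l, T (κ (j + i)) (κ (j + i + 1))) *
        (W κ * U (κ j) (κ 0) * T (κ (j + l)) (κ 0)) := by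
        congr 1
        funext κ
        ring
    _ = sumColors ω (j + 1) fun κ => W κ * ((T ^ (l + 1)) ⊙ U) (κ j) (κ 0) := by
        rw [sumColors_prod_mul T hh]
        simp only [Matrix.mulVec, dotProduct, Matrix.hadamard_apply, pow_succ, Matrix.mul_apply,
          sum_mul, mul_sum]
        congr 1
        funext κ
        exact sum_congr rfl fun z _ => by ring
    _ = _ := hW.sumColors_mul _

end IsTransfer

end Transfer

section Chain

variable {N : ℕ} {R : Type*} [CommRing R] (x : Fin N → R) (ω : ℕ → Fin N)

/-- The weight of a colouring of the path `0, …, m` with the chords `{a₁, b₁}, …, {a_k, b_k}`,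
in which the colour of the vertex `0` is not counted. -/
def chainWeight {k : ℕ} (a b : Fin k → ℕ) (m : ℕ) (κ : ℕ → Fin N) : R :=
  (∏ i ∈ range m, step x (κ i) (κ (i + 1))) * ∏ i, offDiag (Fin N) R (κ (a i)) (κ (b i))

lemma exists_isTransfer_chainWeight {k : ℕ} (a : Fin (k + 1) → ℕ) (b : Fin k → ℕ)
    (hab : ∀ i, a i.castSucc < b i) (hba : ∀ i, b i ≤ a i.succ) :
    ∃ Z ∈ ePosMatrices x, IsTransfer ω (a (Fin.last k))
      (chainWeight x (fun i => a i.castSucc) b (a (Fin.last k))) Z := by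
  induction k with
  | zero =>
    refine ⟨1 * step x ^ a 0, mul_mem (one_mem _) (pow_mem (step_mem_ePosMatrices x) _), ?_⟩
    convert IsTransfer.zero.prod_range (step x) (a 0) using 1
    · exact (zero_add _).symm
    · funext κ
      simp [chainWeight]
  | succ k ih =>
    obtain ⟨Z, hZ, hW⟩ := ih (fun i => a i.castSucc) (fun i => b i.castSucc)
      (fun i => hab i.castSucc) (fun i => hba i.castSucc)
    obtain ⟨l, hl⟩ := Nat.exists_eq_add_of_lt (hab (Fin.last k))
    obtain ⟨r, hr : a (Fin.last (k + 1)) = _⟩ := Nat.exists_eq_add_of_le (hba (Fin.last k))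
    refine ⟨Z * ear x l * step x ^ r, mul_mem (mul_mem hZ (ear_mem_ePosMatrices x l))
      (pow_mem (step_mem_ePosMatrices x) r), ?_⟩
    convert (hW.hadamard (step x) (offDiag (Fin N) R) (l + 1)).prod_range (step x) r using 1
    · rw [hr, hl, add_assoc _ l]
    · funext κ
      simp only [chainWeight, Fin.prod_univ_castSucc, hr, hl, prod_range_add, ← add_assoc]
      ring
    · rfl

lemma sumColors_mem_ePos [IsDomain R] (hinj : Function.Injective x) (h₀ : ∀ c, x c ≠ 0)
    {k m : ℕ} (a : Fin (k + 1) → ℕ) (b : Fin k → ℕ)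
    (hab : ∀ i, a i.castSucc < b i) (hba : ∀ i, b i ≤ a i.succ) (hm : a (Fin.last k) ≤ m) :
    sumColors ω (m + 1) (fun κ => chainWeight x (fun i => a i.castSucc) b m κ *
      step x (κ m) (κ 0) * offDiag (Fin N) R (κ (a (Fin.last k))) (κ 0)) ∈ ePos x := by
  obtain ⟨Z, hZ, hW⟩ := exists_isTransfer_chainWeight x ω a b hab hba
  obtain ⟨l, rfl⟩ := Nat.exists_eq_add_of_le hm
  convert trace_mem_ePos x hinj h₀ (mul_mem hZ (ear_mem_ePosMatrices x l)) using 1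
  rw [ear, ← hW.sumColors_cycle]
  congr 1
  funext κ
  simp only [chainWeight, prod_range_add]
  ring

end Chain

/-- The sum of the monomials of the proper colourings of `G` with colours in a finite set, that is,
the chromatic symmetric function in finitely many variables, evaluated at `x`. -/
noncomputable def colorSum {V σ R : Type*} [Fintype V] [Fintype σ] [CommRing R]
    (G : SimpleGraph V) (x : σ → R) : R :=
  ∑ κ : G.Coloring σ, ∏ v, x (κ v)

section CycleChord

lemma cycleGraph_adj_iff {m : ℕ} (hm : m ≠ 0) (u v : Fin (m + 1)) :
    (SimpleGraph.cycleGraph (m + 1)).Adj u v ↔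
      (u : ℕ) + 1 = v ∨ (v : ℕ) + 1 = u ∨ (u : ℕ) = m ∧ (v : ℕ) = 0 ∨
        (v : ℕ) = m ∧ (u : ℕ) = 0 := by
  have val_sub_eq_one : ∀ u v : Fin (m + 1), ((u - v : Fin (m + 1)) : ℕ) = 1 ↔
      (v : ℕ) + 1 = u ∨ (v : ℕ) = m ∧ (u : ℕ) = 0 := by
    intro u v
    rcases le_or_gt v u with h | h
    · rw [Fin.sub_val_of_le h]
      omega
    · rw [Fin.coe_sub_iff_lt.2 h]
      omega
  rw [SimpleGraph.cycleGraph_adj', val_sub_eq_one, val_sub_eq_one]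
  tauto

lemma forall_cycleGraph_adj_ne_iff {σ : Type*} {m : ℕ} (hm : m ≠ 0) (κ : ℕ → σ) :
    (∀ u v : Fin (m + 1), (SimpleGraph.cycleGraph (m + 1)).Adj u v → κ u ≠ κ v) ↔
      (∀ i < m, κ i ≠ κ (i + 1)) ∧ κ m ≠ κ 0 := by
  simp only [cycleGraph_adj_iff hm]
  constructor
  · intro h
    exact ⟨fun i hi => h ⟨i, by omega⟩ ⟨i + 1, by omega⟩ (Or.inl rfl),
      h (Fin.last m) 0 (Or.inr (Or.inr (Or.inl ⟨rfl, rfl⟩)))⟩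
  · rintro ⟨path, closing⟩ u v (h | h | ⟨h, h'⟩ | ⟨h, h'⟩)
    · rw [← h]; exact path u (by omega)
    · rw [← h]; exact (path v (by omega)).symm
    · rw [h, h']; exact closing
    · rw [h, h']; exact closing.symm

lemma forall_cycleChord_adj_ne_iff {σ : Type*} {m k : ℕ} (hm : m ≠ 0)
    {a : Fin (k + 1) → Fin (m + 1)} {b : Fin k → Fin (m + 1)} (hab : ∀ i, a i.castSucc ≠ b i)
    (hlast : a (Fin.last k) ≠ 0) (κ : ℕ → σ) :
    (∀ u v : Fin (m + 1), (cycleChord (m + 1) a b).Adj u v → κ u ≠ κ v) ↔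
      ((∀ i < m, κ i ≠ κ (i + 1)) ∧ κ m ≠ κ 0) ∧
        (∀ i, κ (a i.castSucc) ≠ κ (b i)) ∧ κ (a (Fin.last k)) ≠ κ 0 := by
  simp only [cycleChord, SimpleGraph.sup_adj, SimpleGraph.fromEdgeSet_adj, or_imp, forall_and,
    forall_cycleGraph_adj_ne_iff hm]
  refine and_congr_right fun _ => ⟨fun h => ⟨fun i => ?_, ?_⟩, ?_⟩
  · exact h _ _ ⟨Or.inl ⟨i, rfl⟩, hab i⟩
  · exact h _ 0 ⟨Or.inr rfl, hlast⟩
  · rintro ⟨chords, lastChord⟩ u v ⟨⟨i, hi⟩ | huv, -⟩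
    · rcases Sym2.eq_iff.1 hi with ⟨rfl, rfl⟩ | ⟨rfl, rfl⟩
      exacts [chords i, (chords i).symm]
    · rcases Sym2.eq_iff.1 huv with ⟨rfl, rfl⟩ | ⟨rfl, rfl⟩
      exacts [lastChord, lastChord.symm]

lemma cycleChord_loop_eq {m : ℕ} (hm : m ≠ 0) (b : Fin 0 → Fin (m + 1)) :
    cycleChord (m + 1) (fun _ : Fin (0 + 1) => 0) b =
      cycleChord (m + 1) (fun _ : Fin (0 + 1) => Fin.last m) b := by
  ext u v
  simp only [cycleChord, SimpleGraph.sup_adj, SimpleGraph.fromEdgeSet_adj, cycleGraph_adj_iff hm,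
    Set.range_eq_empty, Set.empty_union, Set.mem_singleton_iff, Sym2.eq_iff, Fin.ext_iff,
    Fin.val_last, Fin.val_zero, ne_eq]
  omega

end CycleChord

section ColorSum

variable {N : ℕ} {R : Type*} [CommRing R] (x : Fin N → R)

open Classical in
lemma chainWeight_mul_eq_ite {k : ℕ} (a b : Fin k → ℕ) (m c : ℕ) (κ : ℕ → Fin N) :
    chainWeight x a b m κ * step x (κ m) (κ 0) * offDiag (Fin N) R (κ c) (κ 0) =
      if ((∀ i < m, κ i ≠ κ (i + 1)) ∧ κ m ≠ κ 0) ∧ (∀ i, κ (a i) ≠ κ (b i)) ∧ κ c ≠ κ 0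
        then ∏ v : Fin (m + 1), x (κ v) else 0 := by
  have offDiag_eq_ite (c z : Fin N) : offDiag (Fin N) R c z = if c ≠ z then 1 else 0 := by
    rw [offDiag_apply, ite_not]
  have prod_colors : ∏ v : Fin (m + 1), x (κ v) = (∏ i ∈ range m, x (κ (i + 1))) * x (κ 0) := by
    rw [← prod_range_succ' fun i => x (κ i), prod_range fun i => x (κ i)]
  simp only [prod_colors, chainWeight, step_apply, offDiag_eq_ite, prod_mul_distrib, prod_boole,
    mem_range, mem_univ, true_imp_iff, ite_and]
  split_ifs <;> ring

open Classical in
lemma colorSum_eq_sumColors {n : ℕ} (ω : ℕ → Fin N) (G : SimpleGraph (Fin n)) :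
    colorSum G x = sumColors ω n fun κ =>
      if ∀ u v : Fin n, G.Adj u v → κ u ≠ κ v then ∏ v : Fin n, x (κ v) else 0 := by
  have extend_val (κ : Fin n → Fin N) (v : Fin n) : Function.extend Fin.val κ ω v = κ v :=
    Fin.val_injective.extend_apply κ ω v
  simp only [colorSum, sumColors, extend_val]
  refine Fintype.sum_of_injective (fun κ : G.Coloring (Fin N) => ⇑κ) DFunLike.coe_injective _ _
    (fun κ hκ => if_neg fun h => hκ ⟨.mk κ fun huv => h _ _ huv, rfl⟩) fun κ => ?_
  exact (if_pos fun u v huv => κ.valid huv).symm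

lemma colorSum_eq_esymmOn_one {V : Type*} [Unique V] [Fintype V] (G : SimpleGraph V) :
    colorSum G x = esymmOn x univ 1 := by
  rw [esymmOn_eq_sum, powersetCard_one, sum_map, colorSum]
  refine Fintype.sum_equiv ⟨fun κ => κ default, fun c => .mk (fun _ => c) fun {u v} huv =>
    absurd (Subsingleton.elim u v) huv.ne, fun κ => RelHom.ext fun v => ?_, fun c => rfl⟩ _ _
    fun κ => by simp
  rw [Subsingleton.elim v default]
  rfl

variable {x} [NeZero N] [IsDomain R]

lemma colorSum_cycleChord_mem_ePos_of_last_ne_zero (hinj : Function.Injective x)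
    (h₀ : ∀ c, x c ≠ 0) {m k : ℕ} (hm : m ≠ 0) {a : Fin (k + 1) → Fin (m + 1)}
    {b : Fin k → Fin (m + 1)} (hab : ∀ i, a i.castSucc < b i) (hba : ∀ i, b i ≤ a i.succ)
    (hlast : a (Fin.last k) ≠ 0) : colorSum (cycleChord (m + 1) a b) x ∈ ePos x := by
  classical
  rw [colorSum_eq_sumColors x fun _ => 0]
  convert sumColors_mem_ePos x (fun _ => 0) hinj h₀ (fun i => (a i : ℕ)) (fun i => (b i : ℕ)) hab
    hba (Nat.le_of_lt_succ (a (Fin.last k)).isLt) with κ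
  rw [chainWeight_mul_eq_ite]
  exact if_congr (forall_cycleChord_adj_ne_iff hm (fun i => (hab i).ne) hlast κ) rfl rfl

lemma colorSum_cycleChord_mem_ePos (hinj : Function.Injective x) (h₀ : ∀ c, x c ≠ 0) {n k : ℕ}
    [NeZero n] {a : Fin (k + 1) → Fin n} {b : Fin k → Fin n}
    (hab : ∀ i, a i.castSucc < b i) (hba : ∀ i, b i ≤ a i.succ) :
    colorSum (cycleChord n a b) x ∈ ePos x := by
  obtain ⟨m, rfl⟩ := Nat.exists_eq_succ_of_ne_zero (NeZero.ne n)
  rcases eq_or_ne m 0 with rfl | hm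
  · rw [colorSum_eq_esymmOn_one]
    exact esymmOn_univ_mem_ePos x 1
  by_cases hlast : a (Fin.last k) = 0
  · obtain rfl : k = 0 := by
      by_contra hk
      obtain ⟨k, rfl⟩ := Nat.exists_eq_succ_of_ne_zero hk
      have hpos := (hab (Fin.last k)).trans_le (hba (Fin.last k))
      exact Fin.not_lt_zero _ (hlast ▸ hpos)
    rw [show a = fun _ => 0 from funext fun i => (congrArg a (Fin.fin_one_eq_zero i)).trans hlast,
      cycleChord_loop_eq hm]
    exact colorSum_cycleChord_mem_ePos_of_last_ne_zero hinj h₀ hm (fun i => i.elim0)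
      (fun i => i.elim0) (Fin.ext_iff.not.2 hm)
  · exact colorSum_cycleChord_mem_ePos_of_last_ne_zero hinj h₀ hm hab hba hlast

end ColorSum

section PowerSeries

open MvPowerSeries (X coeff monomial killCompl homogeneousComponent)

lemma prod_X_eq_monomial {ι σ R : Type*} [CommSemiring R] (s : Finset ι) (f : ι → σ) :
    ∏ i ∈ s, (X (f i) : MvPowerSeries σ R) = monomial (∑ i ∈ s, Finsupp.single (f i) 1) 1 := by
  simp only [MvPowerSeries.X, MvPowerSeries.prod_monomial, prod_const_one]

lemma sum_single_one_eq_iff {σ : Type*} (T : Finset σ) (d : σ →₀ ℕ) :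
    ∑ i ∈ T, Finsupp.single i 1 = d ↔ T = d.support ∧ ∀ i, d i ≤ 1 := by
  classical
  have sum_single_apply (j : σ) : (∑ i ∈ T, Finsupp.single i 1) j = if j ∈ T then 1 else 0 := by
    simp [Finsupp.finsetSum_apply, Finsupp.single_apply]
  simp only [Finsupp.ext_iff, sum_single_apply, Finset.ext_iff, Finsupp.mem_support_iff,
    ← forall_and]
  refine forall_congr' fun j => ?_
  split_ifs with hj
  · simp only [hj, true_iff]
    omega
  · simp only [hj, false_iff]
    omega

open Classical in
lemma coeff_elem (k : ℕ) (d : ℕ+ →₀ ℕ) :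
    coeff d (elem k) = if d.degree = k ∧ ∀ i, d i ≤ 1 then 1 else 0 := by
  rw [MvPowerSeries.coeff_apply, elem, Set.indicator_apply]
  rfl

open Classical in
lemma coeff_esymmOn_X {σ R : Type*} [Fintype σ] [CommRing R] (k : ℕ) (d : σ →₀ ℕ) :
    coeff d (esymmOn (X : σ → MvPowerSeries σ R) univ k) =
      if d.degree = k ∧ ∀ i, d i ≤ 1 then 1 else 0 := by
  have prod_X (T : Finset σ) :
      ∏ i ∈ T, (X i : MvPowerSeries σ R) = monomial (∑ i ∈ T, Finsupp.single i 1) 1 :=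
    prod_X_eq_monomial T id
  simp only [esymmOn_eq_sum, prod_X, map_sum, MvPowerSeries.coeff_monomial, eq_comm (a := d),
    sum_single_one_eq_iff, ite_and, sum_ite_eq', mem_powersetCard_univ]
  by_cases h : ∀ i, d i ≤ 1
  · have card_support : #d.support = d.degree := by
      rw [Finsupp.degree_apply, card_eq_sum_ones]
      refine sum_congr rfl fun i hi => ?_
      exact le_antisymm (Nat.one_le_iff_ne_zero.2 (Finsupp.mem_support_iff.1 hi)) (h i)
    rw [card_support]
  · simp only [h, if_false, ite_self]

open Classical in
lemma killCompl_elem {σ : Type*} [Fintype σ] (s : σ ↪ ℕ+) (k : ℕ) :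
    killCompl (R := ℤ) s (elem k) = esymmOn X univ k := by
  ext d
  have degree_embDomain : (Finsupp.embDomain s d).degree = d.degree := by
    rw [Finsupp.embDomain_eq_mapDomain, Finsupp.degree_mapDomain]
  have embDomain_le_one : (∀ i, Finsupp.embDomain s d i ≤ 1) ↔ ∀ i, d i ≤ 1 := by
    refine ⟨fun h i => Finsupp.embDomain_apply_self s d i ▸ h (s i), fun h i => ?_⟩
    rw [Finsupp.embDomain_apply]
    split_ifs
    exacts [h _, zero_le_one]
  rw [MvPowerSeries.coeff_killCompl, coeff_elem, coeff_esymmOn_X]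
  exact if_congr (by rw [degree_embDomain, embDomain_le_one]) rfl rfl

lemma coeff_colorSum_X {V σ : Type*} [Fintype V] [Fintype σ] (G : SimpleGraph V) (d : σ →₀ ℕ) :
    coeff d (colorSum G (X : σ → MvPowerSeries σ ℤ)) =
      Nat.card {κ : G.Coloring σ // ∑ v, Finsupp.single (κ v) 1 = d} := by
  classical
  simp only [colorSum, prod_X_eq_monomial, map_sum, MvPowerSeries.coeff_monomial,
    eq_comm (a := d), sum_boole, Nat.card_eq_fintype_card, Fintype.card_subtype]

lemma sum_single_comp_embedding {ι σ τ : Type*} [Fintype ι] (s : σ ↪ τ) (f : ι → σ) :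
    ∑ i, Finsupp.single (s (f i)) 1 = Finsupp.embDomain s (∑ i, Finsupp.single (f i) (1 : ℕ)) := by
  simp only [Finsupp.embDomain_eq_mapDomain, Finsupp.mapDomain_finsetSum, Finsupp.mapDomain_single]

lemma killCompl_chromSymm {V σ : Type*} [Fintype V] [Fintype σ] (G : SimpleGraph V) (s : σ ↪ ℕ+) :
    killCompl (R := ℤ) s (chromSymm G) = colorSum G X := by
  ext d
  rw [MvPowerSeries.coeff_killCompl, coeff_colorSum_X]
  refine congrArg Nat.cast (Nat.card_eq_of_bijective
    (Subtype.map (G.recolorOfEmbedding s) fun κ hκ => ?_) ⟨?_, ?_⟩).symm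
  · exact (sum_single_comp_embedding s κ).trans (congrArg _ hκ)
  · exact Subtype.map_injective _ (G.recolorOfEmbedding s).injective
  · rintro ⟨κ, hκ⟩
    have mem_range : ∀ v, ∃ c, s c = κ v := by
      by_contra! ⟨v, hv⟩
      have h : (∑ u, Finsupp.single (κ u) 1) (κ v) = 0 := by
        rw [hκ]
        exact Finsupp.embDomain_of_notMem_range _ _ _ fun ⟨c, hc⟩ => hv c hc
      rw [Finsupp.finsetSum_apply, sum_eq_zero_iff] at h
      simpa using h v (mem_univ v)
    choose f hf using mem_range
    refine ⟨⟨.mk f fun {u v} huv h => κ.valid huv ?_, Finsupp.embDomain_injective s ?_⟩, ?_⟩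
    · rw [← hf, ← hf, h]
    · rw [← sum_single_comp_embedding, ← hκ]
      exact sum_congr rfl fun v _ => by rw [← hf]; rfl
    · exact Subtype.ext (RelHom.ext hf)

lemma exists_mem_closure_elem_killCompl {σ : Type*} [Fintype σ] {f : MvPowerSeries σ ℤ}
    (hf : f ∈ ePos (X : σ → MvPowerSeries σ ℤ)) :
    ∃ F ∈ Subsemiring.closure (Set.range elem), ∀ s : σ ↪ ℕ+, killCompl s F = f := by
  induction hf using Algebra.adjoin_induction with
  | mem f hf =>
    obtain ⟨k, rfl⟩ := hf
    exact ⟨elem k, Subsemiring.subset_closure ⟨k, rfl⟩, fun s => killCompl_elem s k⟩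
  | algebraMap c => exact ⟨c, natCast_mem _ c, fun s => map_natCast _ c⟩
  | add f g _ _ hf hg =>
    obtain ⟨F, hF, hFf⟩ := hf
    obtain ⟨F', hF', hFf'⟩ := hg
    exact ⟨F + F', add_mem hF hF', fun s => by rw [map_add, hFf, hFf']⟩
  | mul f g _ _ hf hg =>
    obtain ⟨F, hF, hFf⟩ := hf
    obtain ⟨F', hF', hFf'⟩ := hg
    exact ⟨F * F', mul_mem hF hF', fun s => by rw [map_mul, hFf, hFf']⟩

lemma homogeneousComponent_of_isHomogeneous {σ R : Type*} [CommSemiring R] {f : MvPowerSeries σ R}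
    {p : ℕ} (hf : f.IsHomogeneous p) (n : ℕ) :
    homogeneousComponent n f = if p = n then f else 0 := by
  split_ifs with h
  · exact h ▸ (MvPowerSeries.isHomogeneous_iff_eq_homogeneousComponent.1 hf).symm
  · ext d
    rw [MvPowerSeries.coeff_homogeneousComponent, map_zero, ite_eq_right_iff]
    rintro rfl
    exact hf.coeff_eq_zero (Ne.symm h)

lemma isHomogeneous_elem (k : ℕ) : (elem k).IsHomogeneous k := by
  classical
  intro d hd
  rw [coeff_elem, ite_ne_right_iff] at hd
  exact (DFunLike.congr_fun Finsupp.degree_eq_weight_one d).symm.trans hd.1.1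

lemma elem_zero : elem 0 = 1 := by
  classical
  ext d
  rw [MvPowerSeries.coeff_one, coeff_elem]
  refine if_congr ⟨fun h => (Finsupp.degree_eq_zero_iff d).1 h.1, ?_⟩ rfl rfl
  rintro rfl
  exact ⟨map_zero _, fun _ => zero_le_one⟩

lemma isHomogeneous_prod_elem (m : Multiset ℕ) : (m.map elem).prod.IsHomogeneous m.sum := by
  induction m using Multiset.induction_on with
  | empty =>
    rw [Multiset.map_zero, Multiset.prod_zero, Multiset.sum_zero, ← elem_zero]
    exact isHomogeneous_elem 0
  | cons k m ih =>
    rw [Multiset.map_cons, Multiset.prod_cons, Multiset.sum_cons]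
    exact MvPowerSeries.IsHomogeneous.mul (isHomogeneous_elem k) ih

lemma elemPart_ofSums {n : ℕ} (m : Multiset ℕ) (hm : m.sum = n) :
    elemPart (Nat.Partition.ofSums n m hm) = (m.map elem).prod := by
  rw [elemPart, Nat.Partition.ofSums_parts]
  clear hm
  induction m using Multiset.induction_on with
  | empty => rfl
  | cons k m ih =>
    rw [Multiset.map_cons, Multiset.prod_cons, ← ih, Multiset.filter_cons]
    split_ifs with hk
    · rw [Multiset.singleton_add, Multiset.map_cons, Multiset.prod_cons]
    · rw [not_not.1 hk, elem_zero, zero_add, one_mul]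

lemma homogeneousComponent_mem_span {F : MvPowerSeries ℕ+ ℤ}
    (hF : F ∈ Subsemiring.closure (Set.range elem)) (n : ℕ) :
    homogeneousComponent n F ∈ Submodule.span ℕ (Set.range (elemPart (n := n))) := by
  rw [Subsemiring.mem_closure_iff] at hF
  induction hF using AddSubmonoid.closure_induction with
  | mem F hF =>
    obtain ⟨l, hl, rfl⟩ := Submonoid.exists_multiset_of_mem_closure hF
    have : CanLift (MvPowerSeries ℕ+ ℤ) ℕ elem (· ∈ Set.range elem) := ⟨fun _ h => h⟩
    lift l to Multiset ℕ using hl with m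
    rw [homogeneousComponent_of_isHomogeneous (isHomogeneous_prod_elem m)]
    split_ifs with hm
    · exact elemPart_ofSums m hm ▸ Submodule.subset_span ⟨_, rfl⟩
    · exact zero_mem _
  | zero => simp only [map_zero, zero_mem]
  | add F F' _ _ h h' => simpa only [map_add] using add_mem h h'

lemma exists_embedding_embDomain_eq {σ : Type*} [Infinite σ] {N : ℕ} (d : σ →₀ ℕ)
    (hd : d.degree ≤ N) : ∃ (s : Fin N ↪ σ) (d' : Fin N →₀ ℕ), Finsupp.embDomain s d' = d := by
  have card_support_le : #d.support ≤ N := by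
    refine le_trans ?_ hd
    rw [Finsupp.degree_apply, card_eq_sum_ones]
    exact sum_le_sum fun i hi => Nat.one_le_iff_ne_zero.2 (Finsupp.mem_support_iff.1 hi)
  obtain ⟨S, hS, hSN⟩ := Infinite.exists_superset_card_eq d.support N card_support_le
  let s : Fin N ↪ σ := (S.equivFinOfCardEq hSN).symm.toEmbedding.trans (.subtype _)
  refine ⟨s, d.comapDomain s s.injective.injOn, Finsupp.embDomain_comapDomain fun i hi => ?_⟩
  exact ⟨S.equivFinOfCardEq hSN ⟨i, hS hi⟩, by simp [s]⟩

lemma coeff_chromSymm_of_degree_ne {V : Type*} [Fintype V] (G : SimpleGraph V) {d : ℕ+ →₀ ℕ}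
    (hd : d.degree ≠ Fintype.card V) : coeff d (chromSymm G) = 0 := by
  have : IsEmpty {κ : G.Coloring ℕ+ // ∑ v, Finsupp.single (κ v) 1 = d} := by
    refine ⟨fun κ => hd ?_⟩
    rw [← κ.2, map_sum]
    simp
  rw [MvPowerSeries.coeff_apply, chromSymm, Nat.card_of_isEmpty, Nat.cast_zero]

lemma isEPositive_of_colorSum_mem_ePos {V : Type*} [Fintype V] {G : SimpleGraph V} {N : ℕ}
    (hN : Fintype.card V ≤ N)
    (hG : colorSum G (X : Fin N → MvPowerSeries _ ℤ) ∈ ePos (X : Fin N → MvPowerSeries _ ℤ)) :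
    IsEPositive G := by
  obtain ⟨F, hF, hFG⟩ := exists_mem_closure_elem_killCompl hG
  have chromSymm_eq : chromSymm G = homogeneousComponent (Fintype.card V) F := by
    ext d
    rw [MvPowerSeries.coeff_homogeneousComponent]
    split_ifs with hd
    · obtain ⟨s, d', rfl⟩ := exists_embedding_embDomain_eq d (hd.trans_le hN)
      rw [← MvPowerSeries.coeff_killCompl, ← MvPowerSeries.coeff_killCompl, hFG,
        killCompl_chromSymm]
    · exact coeff_chromSymm_of_degree_ne G hd
  obtain ⟨c, hc⟩ := Submodule.mem_span_range_iff_exists_fun ℕ |>.1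
    (homogeneousComponent_mem_span hF (Fintype.card V))
  refine ⟨fun μ => c μ, fun μ => Int.natCast_nonneg _, ?_⟩
  simp only [chromSymm_eq, ← hc, natCast_zsmul]

end PowerSeries

end ChromSymm

theorem mainTheorem5 (n : ℕ) [NeZero n] (k : ℕ) (a : Fin (k + 1) → Fin n) (b : Fin k → Fin n)
    (hab : ∀ i : Fin k, a i.castSucc < b i) (hba : ∀ i : Fin k, b i ≤ a i.succ) :
    ChromSymm.IsEPositive (ChromSymm.cycleChord n a b) := by
  have : IsDomain (MvPowerSeries (Fin n) ℤ) := NoZeroDivisors.to_isDomain _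
  have X_ne_zero (c : Fin n) : (MvPowerSeries.X c : MvPowerSeries (Fin n) ℤ) ≠ 0 := fun h => by
    have := congrArg (MvPowerSeries.coeff (Finsupp.single c 1)) h
    rw [MvPowerSeries.coeff_index_single_self_X, map_zero] at this
    exact one_ne_zero this
  exact ChromSymm.isEPositive_of_colorSum_mem_ePos (Fintype.card_fin n).le
    (ChromSymm.colorSum_cycleChord_mem_ePos (fun _ _ => MvPowerSeries.X_inj.1) X_ne_zero hab hba)
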